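/- Let $N$ be a positive integer and let $\{A(t)\}_{t\ge 0}$ be a family of real $N\times N$ matrices such that every $A(t)$ has nonnegative off-diagonal entries and zero row sums, and such that the entries $a_{ij}(t)$ are measurable and locally integrable functions of $t\in[0,\infty)$. Let $\Phi(t,\tau)$, $t\ge\tau\ge 0$, be the state transition matrix of $\dot x(t)=A(t)x(t)$, given by its Peano–Baker series $$\Phi(t,\tau)=I+\int_\tau^t A(\sigma_1)\,d\sigma_1+\int_\tau^t A(\sigma_1)\int_\tau^{\sigma_1}A(\sigma_2)\,d\sigma_2\,d\sigma_1+\cdots .$$ For $\tau\ge 0$ let $\mathcal N_\tau(A)=\{v\in\mathbb R^N : \lim_{t\to\infty}\Phi(t,\tau)v=0\}$. The dimension of this vector space does not depend on $\tau$; it is called $\mathrm{null}(A)$, and $\mathrm{Rank}(A)=N-\mathrm{null}(A)$. For $t\ge\tau\ge 0$ let $C_{t,\tau}\subset\mathbb R^N$ be the convex hull of the columns of the transpose $\Phi'(t,\tau)$. Then for every $\tau\ge 0$ the polytopes $C_{t,\tau}$ decrease as $t$ increases over $[\tau,\infty)$, and as $t\to\infty$ they converge in the Hausdorff distance to $C_\tau=\bigcap_{t\ge\tau}C_{t,\tau}$,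 which is again a polytope (the convex hull of a finite set). The number $c$ of vertices of $C_\tau$ does not depend on $\tau$, the vertices of $C_\tau$ are linearly independent vectors of $\mathbb R^N$ for every $\tau\ge 0$, and $$\mathrm{Rank}(A)=c.$$ -/

import Mathlib

open Set Filter Topology MeasureTheory

/-- A continuous time chain `{A(t)}_{t ≥ 0}` on `N` individuals: every `A(t)`, `t ≥ 0`, has
nonnegative off-diagonal entries and zero row sums, and the entries are (Lebesgue measurable and)
integrable on compact subsets of `[0, ∞)`. -/
structure IsIntensityChain {N : ℕ} (A : ℝ → Matrix (Fin N) (Fin N) ℝ) : Prop where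
  offDiag_nonneg : ∀ t, 0 ≤ t → ∀ i j, i ≠ j → 0 ≤ A t i j
  row_sum : ∀ t, 0 ≤ t → ∀ i, ∑ j, A t i j = 0
  locallyIntegrable : ∀ i j, LocallyIntegrableOn (fun t => A t i j) (Ici 0) volume

/-- The `n`-th term, at time `t`, of the Peano-Baker series started at time `τ`: the `n`-fold
iterated integral `∫_τ^t A(σ₁) ∫_τ^σ₁ A(σ₂) ⋯ dσ₂ dσ₁` (integrals are taken entrywise). -/
noncomputable def peanoBakerTerm {N : ℕ} (A : ℝ → Matrix (Fin N) (Fin N) ℝ) (τ : ℝ) :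
    ℕ → ℝ → Matrix (Fin N) (Fin N) ℝ
  | 0, _ => 1
  | n + 1, t => Matrix.of fun i j => ∫ σ in τ..t, (A σ * peanoBakerTerm A τ n σ) i j

/-- The state transition matrix `Φ(t, τ)`, `t ≥ τ ≥ 0`, of `x' = A(t) x`, given by its Peano-Baker
series (which converges absolutely for every chain `A`). -/
noncomputable def stateTransition {N : ℕ} (A : ℝ → Matrix (Fin N) (Fin N) ℝ) (t τ : ℝ) :
    Matrix (Fin N) (Fin N) ℝ :=
  ∑' n, peanoBakerTerm A τ n t

/-- The null space of the chain at time `τ`: all `v` with `Φ(t, τ) v → 0` as `t → ∞`. -/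
noncomputable def nullSpace {N : ℕ} (A : ℝ → Matrix (Fin N) (Fin N) ℝ) (τ : ℝ) :
    Submodule ℝ (Fin N → ℝ) where
  carrier := {v | Tendsto (fun t => (stateTransition A t τ).mulVec v) atTop (𝓝 0)}
  add_mem' := by
    intro a b ha hb
    simpa [Matrix.mulVec_add] using Tendsto.add ha hb
  zero_mem' := by simp
  smul_mem' := by
    intro r a ha
    simpa [Matrix.mulVec_smul] using Tendsto.const_smul ha r

/-- The nullity of the chain: the dimension of its null space, which does not depend on the time
and is taken at time `0` here. -/
noncomputable def nullity {N : ℕ} (A : ℝ → Matrix (Fin N) (Fin N) ℝ) : ℕ :=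
  Module.finrank ℝ (nullSpace A 0)

/-- The rank of the chain. -/
noncomputable def chainRank {N : ℕ} (A : ℝ → Matrix (Fin N) (Fin N) ℝ) : ℕ :=
  N - nullity A

/-- `C_{t,τ}`: the convex hull of the columns of the transpose of `Φ(t, τ)`. -/
noncomputable def polytope {N : ℕ} (A : ℝ → Matrix (Fin N) (Fin N) ℝ) (t τ : ℝ) :
    Set (Fin N → ℝ) :=
  convexHull ℝ (range (stateTransition A t τ).transpose.col)

/-- `C_τ`: the limit of the decreasing family `C_{t,τ}`, `t ≥ τ`, that is, its intersection. -/
noncomputable def limitPolytope {N : ℕ} (A : ℝ → Matrix (Fin N) (Fin N) ℝ) (τ : ℝ) :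
    Set (Fin N → ℝ) :=
  ⋂ t ∈ Ici τ, polytope A t τ

/-- The set of vertices of `C_τ`. -/
noncomputable def limitVertices {N : ℕ} (A : ℝ → Matrix (Fin N) (Fin N) ℝ) (τ : ℝ) :
    Set (Fin N → ℝ) :=
  (limitPolytope A τ).extremePoints ℝ

/-!
By the cocycle identity `Φ(t, τ) = Φ(t, s) Φ(s, τ)`, with row-stochastic factors, the polytopes
`C_{t,τ}` spanned by the rows of `Φ(t, τ)` decrease in `t` and the norms `‖Φ(t, τ) v‖` do not
increase. Let `Q` be the limit of `Φ(t, τ)` along an ultrafilter finer than `t → ∞`. By compactness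
`C_τ` is the convex hull of the rows of `Q`, and by monotonicity of the norms
`Φ(t, τ) v → 0` if and only if `Q v = 0`.

An extreme point of `C_τ` is a convex combination of the rows of each `Φ(t, τ)`, and in the limit
its weights live on the rows of `Q` equal to it. Distinct vertices thus have limit weights with
disjoint supports; their weights for some finite `t` are then still linearly independent, and as
`Φ(t, τ)` is invertible so are the vertices themselves. Being a basis of the row space of `Q`, they
number `Q.rank = N - null(A)`.
-/

section Primitive

variable {a b s t τ : ℝ} {f g F G : ℝ → ℝ}

theorem absolutelyContinuousOnInterval_of_dist_le {X Y : Type*} [PseudoMetricSpace X]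
    [PseudoMetricSpace Y] {F : ℝ → X} {G : ℝ → Y} (K : ℝ)
    (hF : AbsolutelyContinuousOnInterval F a b)
    (h : ∀ x ∈ uIcc a b, ∀ y ∈ uIcc a b, dist (G x) (G y) ≤ K * dist (F x) (F y)) :
    AbsolutelyContinuousOnInterval G a b := by
  have hlim := Tendsto.const_mul K hF
  rw [mul_zero] at hlim
  refine squeeze_zero' (.of_forall fun E => Finset.sum_nonneg fun _ _ => dist_nonneg) ?_ hlim
  rw [eventually_inf_principal]
  filter_upwards with E hE
  rw [Finset.mul_sum]
  exact Finset.sum_le_sum fun i hi => h _ (hE.1 i hi).1 _ (hE.1 i hi).2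

theorem intervalIntegrable_of_locallyIntegrableOn {E : Type*} [NormedAddCommGroup E] {f : ℝ → E}
    {S : Set ℝ} [S.OrdConnected] (hf : LocallyIntegrableOn f S volume) (hs : s ∈ S) (ht : t ∈ S) :
    IntervalIntegrable f volume s t :=
  (hf.integrableOn_compact_subset (OrdConnected.uIcc_subset ‹_› hs ht)
    isCompact_uIcc).intervalIntegrable

theorem locallyIntegrableOn_finsetSum {X E ι : Type*} [MeasurableSpace X] [TopologicalSpace X]
    [NormedAddCommGroup E] {μ : Measure X} {S : Set X} {f : ι → X → E} (s : Finset ι)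
    (hf : ∀ i ∈ s, LocallyIntegrableOn (f i) S μ) :
    LocallyIntegrableOn (fun x => ∑ i ∈ s, f i x) S μ := by
  classical
  induction s using Finset.induction_on with
  | empty => simpa only [Finset.sum_empty] using locallyIntegrableOn_zero
  | insert i s hi ih =>
    simp only [Finset.sum_insert hi]
    exact (hf i (Finset.mem_insert_self i s)).add
      (ih fun j hj => hf j (Finset.mem_insert_of_mem hj))

/-- `F` is locally absolutely continuous on `[a, ∞)` with almost everywhere derivative `f`. This is
encoded by the fundamental theorem of calculus, so that `f` is literally the integrand. -/
structure IsPrimitiveOnIci (a : ℝ) (F f : ℝ → ℝ) : Prop where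
  locallyIntegrableOn : LocallyIntegrableOn f (Ici a) volume
  integral_eq_sub : ∀ s ∈ Ici a, ∀ t ∈ Ici a, ∫ σ in s..t, f σ = F t - F s

theorem isPrimitiveOnIci_integral (hf : LocallyIntegrableOn f (Ici a) volume) (hτ : τ ∈ Ici a) :
    IsPrimitiveOnIci a (fun t => ∫ σ in τ..t, f σ) f :=
  ⟨hf, fun _ hs _ ht => (intervalIntegral.integral_interval_sub_left
    (intervalIntegrable_of_locallyIntegrableOn hf hτ ht)
    (intervalIntegrable_of_locallyIntegrableOn hf hτ hs)).symm⟩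

theorem isPrimitiveOnIci_of_absolutelyContinuous (hf : LocallyIntegrableOn f (Ici a) volume)
    (hF : ∀ s ∈ Ici a, ∀ t ∈ Ici a, AbsolutelyContinuousOnInterval F s t)
    (hFf : ∀ s ∈ Ici a, ∀ t ∈ Ici a, ∀ᵐ x, x ∈ uIcc s t → HasDerivAt F (f x) x) :
    IsPrimitiveOnIci a F f := by
  refine ⟨hf, fun s hs t ht => ?_⟩
  rw [← (hF s hs t ht).integral_deriv_eq_sub]
  refine intervalIntegral.integral_congr_ae ?_
  filter_upwards [hFf s hs t ht] with x hx hxI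
  exact (hx (uIoc_subset_uIcc hxI)).deriv.symm

namespace IsPrimitiveOnIci

theorem intervalIntegrable (hF : IsPrimitiveOnIci a F f) (hs : s ∈ Ici a) (ht : t ∈ Ici a) :
    IntervalIntegrable f volume s t :=
  intervalIntegrable_of_locallyIntegrableOn hF.locallyIntegrableOn hs ht

theorem eq_add_integral (hF : IsPrimitiveOnIci a F f) (hs : s ∈ Ici a) (ht : t ∈ Ici a) :
    F t = F s + ∫ σ in s..t, f σ := by
  rw [hF.integral_eq_sub s hs t ht, add_sub_cancel]

theorem absolutelyContinuousOnInterval (hF : IsPrimitiveOnIci a F f) (hs : s ∈ Ici a)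
    (ht : t ∈ Ici a) : AbsolutelyContinuousOnInterval F s t := by
  have hsub : uIcc s t ⊆ Ici a := OrdConnected.uIcc_subset inferInstance hs ht
  refine absolutelyContinuousOnInterval_of_dist_le 1
    ((hF.intervalIntegrable hs ht).absolutelyContinuousOnInterval_intervalIntegral
      left_mem_uIcc) fun x hx y hy => ?_
  rw [one_mul, hF.eq_add_integral hs (hsub hx), hF.eq_add_integral hs (hsub hy), dist_add_left]

theorem ae_hasDerivAt (hF : IsPrimitiveOnIci a F f) (hs : s ∈ Ici a) (ht : t ∈ Ici a) :
    ∀ᵐ x, x ∈ uIcc s t → HasDerivAt F (f x) x := by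
  have hne (c : ℝ) : ∀ᵐ x : ℝ, x ≠ c := Measure.ae_ne volume c
  filter_upwards [(hF.intervalIntegrable hs ht).ae_hasDerivAt_integral, hne s, hne t]
    with x hx hxs hxt hxI
  refine ((hx hxI s left_mem_uIcc).const_add (F s)).congr_of_eventuallyEq ?_
  have hnhds : uIcc s t ∈ 𝓝 x := by
    rcases le_total s t with hst | hst
    · rw [uIcc_of_le hst] at hxI ⊢
      exact Icc_mem_nhds (hxI.1.lt_of_ne' hxs) (hxI.2.lt_of_ne hxt)
    · rw [uIcc_of_ge hst] at hxI ⊢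
      exact Icc_mem_nhds (hxI.1.lt_of_ne' hxt) (hxI.2.lt_of_ne hxs)
  filter_upwards [hnhds] with y hy
  exact hF.eq_add_integral hs (OrdConnected.uIcc_subset inferInstance hs ht hy)

theorem continuousOn (hF : IsPrimitiveOnIci a F f) : ContinuousOn F (Ici a) := by
  intro t ht
  have hlt : t < t + 1 := lt_add_one t
  have hle : a ≤ t + 1 := (mem_Ici.1 ht).trans hlt.le
  have hcont := (hF.absolutelyContinuousOnInterval self_mem_Ici hle).continuousOn
  rw [uIcc_of_le hle] at hcont
  exact (hcont t ⟨ht, hlt.le⟩).mono_of_mem_nhdsWithin <| by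
    rw [← Ici_inter_Iic]
    exact inter_mem self_mem_nhdsWithin (mem_nhdsWithin_of_mem_nhds (Iic_mem_nhds hlt))

theorem sub (hF : IsPrimitiveOnIci a F f) (hG : IsPrimitiveOnIci a G g) :
    IsPrimitiveOnIci a (fun x => F x - G x) fun x => f x - g x := by
  refine ⟨hF.locallyIntegrableOn.sub hG.locallyIntegrableOn, fun s hs t ht => ?_⟩
  rw [intervalIntegral.integral_sub (hF.intervalIntegrable hs ht) (hG.intervalIntegrable hs ht),
    hF.integral_eq_sub s hs t ht, hG.integral_eq_sub s hs t ht]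
  ring

theorem sum_mul_const {ι : Type*} [Fintype ι] {F f : ι → ℝ → ℝ}
    (hF : ∀ i, IsPrimitiveOnIci a (F i) (f i)) (c : ι → ℝ) :
    IsPrimitiveOnIci a (fun x => ∑ i, F i x * c i) fun x => ∑ i, f i x * c i := by
  refine ⟨locallyIntegrableOn_finsetSum _ fun i _ =>
    (hF i).locallyIntegrableOn.mul_continuousOn continuousOn_const isClosed_Ici.isLocallyClosed,
    fun s hs t ht => ?_⟩
  rw [intervalIntegral.integral_finsetSum fun i _ =>
    ((hF i).intervalIntegrable hs ht).mul_const (c i), ← Finset.sum_sub_distrib]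
  refine Finset.sum_congr rfl fun i _ => ?_
  rw [intervalIntegral.integral_mul_const, (hF i).integral_eq_sub s hs t ht, sub_mul]

theorem hasSum {F f : ℕ → ℝ → ℝ} {c : ℕ → ℝ} {h : ℝ → ℝ}
    (hF : ∀ k, IsPrimitiveOnIci a (F k) (f k)) (hg : LocallyIntegrableOn g (Ici a) volume)
    (hc : Summable c) (hfg : ∀ k, ∀ t ∈ Ici a, |f k t| ≤ c k * g t)
    (hFG : ∀ t ∈ Ici a, HasSum (fun k => F k t) (G t))
    (hfh : ∀ t ∈ Ici a, HasSum (fun k => f k t) (h t)) : IsPrimitiveOnIci a G h := by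
  have hbound : ∀ t ∈ Ici a, |h t| ≤ (∑' k, c k) * g t := fun t ht => by
    rw [← Real.norm_eq_abs, ← (hfh t ht).tsum_eq, ← tsum_mul_right]
    exact tsum_of_norm_bounded (hc.mul_right (g t)).hasSum fun k => hfg k t ht
  have hmeas : AEStronglyMeasurable h (volume.restrict (Ici a)) :=
    aestronglyMeasurable_of_tendsto_ae atTop
      (fun n => (locallyIntegrableOn_finsetSum (Finset.range n) fun k _ =>
        (hF k).locallyIntegrableOn).aestronglyMeasurable)
      ((ae_restrict_iff' measurableSet_Ici).2 <| .of_forall fun t ht =>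
        (hfh t ht).tendsto_sum_nat)
  have hint : LocallyIntegrableOn h (Ici a) volume := by
    refine (locallyIntegrableOn_iff isClosed_Ici.isLocallyClosed).2 fun K hK hKc => ?_
    refine Integrable.mono' ((hg.integrableOn_compact_subset hK hKc).const_mul (∑' k, c k))
      (hmeas.mono_set hK) ?_
    filter_upwards [ae_restrict_mem hKc.measurableSet] with t ht using hbound t (hK ht)
  refine ⟨hint, fun s hs t ht => ?_⟩
  have hsub : uIoc s t ⊆ Ici a :=
    uIoc_subset_uIcc.trans (OrdConnected.uIcc_subset inferInstance hs ht)
  have hgi := intervalIntegrable_of_locallyIntegrableOn hg hs ht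
  have hsum : HasSum (fun k => ∫ σ in s..t, f k σ) (∫ σ in s..t, h σ) := by
    refine intervalIntegral.hasSum_integral_of_dominated_convergence (fun k σ => c k * g σ)
      (fun k => ((hF k).intervalIntegrable hs ht).def'.aestronglyMeasurable)
      (fun k => .of_forall fun σ hσ => hfg k σ (hsub hσ))
      (.of_forall fun σ _ => hc.mul_right (g σ)) ?_ (.of_forall fun σ hσ => hfh σ (hsub hσ))
    simpa only [tsum_mul_right] using hgi.const_mul (∑' k, c k)
  refine hsum.unique ?_
  simpa only [(hF _).integral_eq_sub s hs t ht] using (hFG t ht).sub (hFG s hs)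

theorem mul (hF : IsPrimitiveOnIci a F f) (hG : IsPrimitiveOnIci a G g) :
    IsPrimitiveOnIci a (fun x => F x * G x) fun x => f x * G x + F x * g x := by
  refine isPrimitiveOnIci_of_absolutelyContinuous
    ((hF.locallyIntegrableOn.mul_continuousOn hG.continuousOn isClosed_Ici.isLocallyClosed).add
      (hG.locallyIntegrableOn.continuousOn_mul hF.continuousOn isClosed_Ici.isLocallyClosed))
    (fun s hs t ht => (hF.absolutelyContinuousOnInterval hs ht).fun_mul
      (hG.absolutelyContinuousOnInterval hs ht)) fun s hs t ht => ?_
  filter_upwards [hF.ae_hasDerivAt hs ht, hG.ae_hasDerivAt hs ht] with x hFx hGx hx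
  exact (hFx hx).mul (hGx hx)

theorem comp {φ φ' : ℝ → ℝ} (hF : IsPrimitiveOnIci a F f) (hφ : ∀ x, HasDerivAt φ (φ' x) x)
    (hφ' : Continuous φ') : IsPrimitiveOnIci a (fun x => φ (F x)) fun x => φ' (F x) * f x := by
  have hφC : ContDiff ℝ 1 φ := contDiff_one_iff_deriv.2
    ⟨fun x => (hφ x).differentiableAt, (funext fun x => (hφ x).deriv) ▸ hφ'⟩
  refine isPrimitiveOnIci_of_absolutelyContinuous
    (hF.locallyIntegrableOn.continuousOn_mul (hφ'.comp_continuousOn hF.continuousOn)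
      isClosed_Ici.isLocallyClosed) (fun s hs t ht => ?_) fun s hs t ht => ?_
  · have hFac := hF.absolutelyContinuousOnInterval hs ht
    obtain ⟨K, hK⟩ := hφC.locallyLipschitz.locallyLipschitzOn
      |>.exists_lipschitzOnWith_of_compact (isCompact_uIcc.image_of_continuousOn hFac.continuousOn)
    exact absolutelyContinuousOnInterval_of_dist_le K hFac fun x hx y hy =>
      hK.dist_le_mul _ (mem_image_of_mem F hx) _ (mem_image_of_mem F hy)
  · filter_upwards [hF.ae_hasDerivAt hs ht] with x hFx hx
    exact (hφ (F x)).comp x (hFx hx)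

end IsPrimitiveOnIci

end Primitive

section Solution

variable {n p q : Type*} [Fintype n] {a t τ : ℝ} {A : ℝ → Matrix n n ℝ} {X Y : ℝ → Matrix n p ℝ}

theorem abs_mul_apply_le {B : Matrix n n ℝ} {M : Matrix n p ℝ} {C : ℝ} (hM : ∀ i j, |M i j| ≤ C)
    (i : n) (j : p) : |(B * M) i j| ≤ (∑ i, ∑ j, |B i j|) * C := by
  have hC : 0 ≤ C := (abs_nonneg _).trans (hM i j)
  calc |(B * M) i j| ≤ ∑ k, |B i k * M k j| := by
        rw [Matrix.mul_apply]; exact Finset.abs_sum_le_sum_abs _ _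
    _ ≤ ∑ k, |B i k| * C := Finset.sum_le_sum fun k _ => by
        rw [abs_mul]; exact mul_le_mul_of_nonneg_left (hM k j) (abs_nonneg _)
    _ = (∑ k, |B i k|) * C := by rw [Finset.sum_mul]
    _ ≤ _ := mul_le_mul_of_nonneg_right
        (Finset.single_le_sum (f := fun i => ∑ j, |B i j|)
          (fun i _ => Finset.sum_nonneg fun j _ => abs_nonneg _) (Finset.mem_univ i)) hC

theorem locallyIntegrableOn_sum_abs
    (hA : ∀ i j, LocallyIntegrableOn (fun t => A t i j) (Ici a) volume) :
    LocallyIntegrableOn (fun t => ∑ i, ∑ j, |A t i j|) (Ici a) volume :=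
  locallyIntegrableOn_finsetSum _ fun i _ => locallyIntegrableOn_finsetSum _ fun j _ =>
    (hA i j).norm

theorem locallyIntegrableOn_mul_apply
    (hA : ∀ i j, LocallyIntegrableOn (fun t => A t i j) (Ici a) volume)
    (hX : ∀ i j, ContinuousOn (fun t => X t i j) (Ici a)) (i : n) (j : p) :
    LocallyIntegrableOn (fun t => (A t * X t) i j) (Ici a) volume := by
  simp only [Matrix.mul_apply]
  exact locallyIntegrableOn_finsetSum _ fun k _ =>
    (hA i k).mul_continuousOn (hX k j) isClosed_Ici.isLocallyClosed

/-- `X` is a Carathéodory solution of the matrix equation `X' = A(t) X` on `[a, ∞)`. -/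
def IsSolutionOnIci (a : ℝ) (A : ℝ → Matrix n n ℝ) (X : ℝ → Matrix n p ℝ) : Prop :=
  ∀ i j, IsPrimitiveOnIci a (fun t => X t i j) fun t => (A t * X t) i j

namespace IsSolutionOnIci

theorem sub (hX : IsSolutionOnIci a A X) (hY : IsSolutionOnIci a A Y) :
    IsSolutionOnIci a A fun t => X t - Y t := fun i j => by
  simpa only [Matrix.mul_sub, Matrix.sub_apply] using (hX i j).sub (hY i j)

theorem mul_const [Fintype p] (hX : IsSolutionOnIci a A X) (C : Matrix p q ℝ) :
    IsSolutionOnIci a A fun t => X t * C := fun i j => by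
  simpa only [← Matrix.mul_assoc, Matrix.mul_apply (N := C)] using
    IsPrimitiveOnIci.sum_mul_const (fun k => hX i k) fun k => C k j

theorem exp_smul [DecidableEq n] {w W : ℝ → ℝ} (hX : IsSolutionOnIci a A X)
    (hW : IsPrimitiveOnIci a W w) :
    IsSolutionOnIci a (fun t => A t + w t • 1) fun t => Real.exp (W t) • X t := fun i j => by
  have hmul := (hW.comp Real.hasDerivAt_exp Real.continuous_exp).mul (hX i j)
  simp only [Matrix.add_mul, Matrix.mul_smul, Matrix.smul_mul, Matrix.one_mul, Matrix.add_apply,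
    Matrix.smul_apply, smul_eq_mul]
  convert hmul using 2 with t
  ring

end IsSolutionOnIci

theorem isSolutionOnIci_const
    (hA : ∀ i j, LocallyIntegrableOn (fun t => A t i j) (Ici a) volume) {C : Matrix n p ℝ}
    (hC : ∀ t ∈ Ici a, A t * C = 0) : IsSolutionOnIci a A fun _ => C := fun i j => by
  refine ⟨locallyIntegrableOn_mul_apply (X := fun _ => C) hA (fun _ _ => continuousOn_const) i j,
    fun s hs t ht => ?_⟩
  have hzero : EqOn (fun σ => (A σ * C) i j) (fun _ => 0) (uIcc s t) := fun σ hσ => by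
    simp only [hC σ (OrdConnected.uIcc_subset inferInstance hs ht hσ), Matrix.zero_apply]
  rw [intervalIntegral.integral_congr hzero, intervalIntegral.integral_zero, sub_self]

/- The weight `cosh (2 W)` makes one Picard iteration a contraction by `1 / 2` on all of `[a, ∞)`.
Unlike `exp (2 W)`, it also does so for times before `τ`. -/
theorem abs_apply_le_cosh_of_isPrimitiveOnIci {W : ℝ → ℝ} {C : ℝ} {i : n} {j : p}
    (hW : IsPrimitiveOnIci a W fun t => ∑ i, ∑ j, |A t i j|) (hτ : τ ∈ Ici a) (hWτ : W τ = 0)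
    (hX : IsPrimitiveOnIci a (fun t => X t i j) fun t => (A t * Y t) i j) (hXτ : X τ i j = 0)
    (ht : t ∈ Ici a) (hY : ∀ σ ∈ uIcc τ t, ∀ i j, |Y σ i j| ≤ C * Real.cosh (2 * W σ)) :
    |X t i j| ≤ C / 2 * Real.cosh (2 * W t) := by
  have hsinh : IsPrimitiveOnIci a (fun t => C / 2 * Real.sinh (2 * W t))
      fun t => C * Real.cosh (2 * W t) * ∑ i, ∑ j, |A t i j| := by
    refine hW.comp (φ := fun x => C / 2 * Real.sinh (2 * x))
      (φ' := fun x => C * Real.cosh (2 * x)) (fun x => ?_) (by fun_prop)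
    exact (((hasDerivAt_id x).const_mul 2).sinh.const_mul (C / 2)).congr_deriv (by
      simp only [id]; ring)
  have hC : 0 ≤ C / 2 := by
    have h := (abs_nonneg _).trans (hY τ left_mem_uIcc i j)
    rw [hWτ, mul_zero, Real.cosh_zero, mul_one] at h
    exact div_nonneg h zero_le_two
  calc |X t i j| = ‖∫ σ in τ..t, (A σ * Y σ) i j‖ := by
        rw [hX.integral_eq_sub τ hτ t ht, hXτ, sub_zero, Real.norm_eq_abs]
    _ ≤ |∫ σ in τ..t, C * Real.cosh (2 * W σ) * (∑ i, ∑ j, |A σ i j|)| := by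
        refine intervalIntegral.norm_integral_le_abs_of_norm_le ?_ (hsinh.intervalIntegrable hτ ht)
        filter_upwards [ae_restrict_mem measurableSet_uIoc] with σ hσ
        rw [mul_comm]
        exact abs_mul_apply_le (hY σ (uIoc_subset_uIcc hσ)) i j
    _ = C / 2 * Real.sinh |2 * W t| := by
        rw [hsinh.integral_eq_sub τ hτ t ht, hWτ, mul_zero, Real.sinh_zero, mul_zero, sub_zero,
          abs_mul, abs_of_nonneg hC, Real.abs_sinh]
    _ ≤ C / 2 * Real.cosh (2 * W t) := by
        rw [← Real.cosh_abs]
        exact mul_le_mul_of_nonneg_left (Real.sinh_lt_cosh _).le hC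

theorem IsSolutionOnIci.eq_zero [Finite p]
    (hA : ∀ i j, LocallyIntegrableOn (fun t => A t i j) (Ici a) volume)
    (hX : IsSolutionOnIci a A X) (hτ : τ ∈ Ici a) (hXτ : X τ = 0) (ht : t ∈ Ici a) : X t = 0 := by
  have hW := isPrimitiveOnIci_integral (locallyIntegrableOn_sum_abs hA) hτ
  set W : ℝ → ℝ := fun t => ∫ σ in τ..t, ∑ i, ∑ j, |A σ i j|
  have hsub : uIcc τ t ⊆ Ici a := OrdConnected.uIcc_subset inferInstance hτ ht
  choose C hC using fun i j =>
    isCompact_uIcc.exists_bound_of_continuousOn ((hX i j).continuousOn.mono hsub)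
  obtain ⟨M, hM⟩ := finite_range (fun ij : n × p => C ij.1 ij.2) |>.bddAbove
  have hXM : ∀ σ ∈ uIcc τ t, ∀ i j, |X σ i j| ≤ M := fun σ hσ i j =>
    (hC i j σ hσ).trans (hM (mem_range_self (i, j)))
  have hbound (k : ℕ) : ∀ σ ∈ uIcc τ t, ∀ i j, |X σ i j| ≤ M / 2 ^ k * Real.cosh (2 * W σ) := by
    induction k with
    | zero =>
      intro σ hσ i j
      rw [pow_zero, div_one]
      have hM0 : 0 ≤ M := (abs_nonneg _).trans (hXM σ hσ i j)
      exact (hXM σ hσ i j).trans (le_mul_of_one_le_right hM0 (Real.one_le_cosh _))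
    | succ k ih =>
      intro σ hσ i j
      rw [pow_succ, ← div_div]
      exact abs_apply_le_cosh_of_isPrimitiveOnIci hW hτ intervalIntegral.integral_same (hX i j)
        (by rw [hXτ]; rfl) (hsub hσ) fun ρ hρ => ih ρ (uIcc_subset_uIcc_left hσ hρ)
  ext i j
  have hlim : Tendsto (fun k : ℕ => M / 2 ^ k * Real.cosh (2 * W t)) atTop (𝓝 0) := by
    rw [← zero_mul (Real.cosh (2 * W t))]
    exact (tendsto_const_nhds.div_atTop
      (tendsto_pow_atTop_atTop_of_one_lt one_lt_two)).mul_const _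
  exact abs_nonpos_iff.1 (ge_of_tendsto' hlim fun k => hbound k t right_mem_uIcc i j)

theorem IsSolutionOnIci.eq_of_eq [Finite p]
    (hA : ∀ i j, LocallyIntegrableOn (fun t => A t i j) (Ici a) volume)
    (hX : IsSolutionOnIci a A X) (hY : IsSolutionOnIci a A Y) (hτ : τ ∈ Ici a) (hXY : X τ = Y τ)
    (ht : t ∈ Ici a) : X t = Y t :=
  sub_eq_zero.1 <| (hX.sub hY).eq_zero hA hτ (sub_eq_zero.2 hXY) ht

end Solution

section PeanoBaker

open scoped Matrix

variable {N : ℕ} {A : ℝ → Matrix (Fin N) (Fin N) ℝ} {a s t τ : ℝ}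

theorem continuousOn_peanoBakerTerm
    (hA : ∀ i j, LocallyIntegrableOn (fun t => A t i j) (Ici a) volume) (hτ : τ ∈ Ici a) (n : ℕ)
    (i j : Fin N) : ContinuousOn (fun t => peanoBakerTerm A τ n t i j) (Ici a) := by
  induction n generalizing i j with
  | zero => exact continuousOn_const
  | succ n ih =>
    exact (isPrimitiveOnIci_integral (locallyIntegrableOn_mul_apply hA ih i j) hτ).continuousOn

theorem isPrimitiveOnIci_peanoBakerTerm_succ
    (hA : ∀ i j, LocallyIntegrableOn (fun t => A t i j) (Ici a) volume) (hτ : τ ∈ Ici a) (n : ℕ)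
    (i j : Fin N) : IsPrimitiveOnIci a (fun t => peanoBakerTerm A τ (n + 1) t i j)
      fun t => (A t * peanoBakerTerm A τ n t) i j :=
  isPrimitiveOnIci_integral
    (locallyIntegrableOn_mul_apply hA (continuousOn_peanoBakerTerm hA hτ n) i j) hτ

theorem peanoBakerTerm_succ_self (A : ℝ → Matrix (Fin N) (Fin N) ℝ) (τ : ℝ) (n : ℕ) :
    peanoBakerTerm A τ (n + 1) τ = 0 :=
  Matrix.ext fun _ _ => intervalIntegral.integral_same

theorem abs_peanoBakerTerm_apply_le
    (hA : ∀ i j, LocallyIntegrableOn (fun t => A t i j) (Ici a) volume) (hτ : τ ∈ Ici a)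
    (n : ℕ) (ht : t ∈ Ici a) (i j : Fin N) :
    |peanoBakerTerm A τ n t i j| ≤
      (1 / 2) ^ n * Real.cosh (2 * ∫ σ in τ..t, ∑ i, ∑ j, |A σ i j|) := by
  induction n generalizing t i j with
  | zero =>
    rw [pow_zero, one_mul]
    refine le_trans ?_ (Real.one_le_cosh _)
    by_cases hij : i = j <;> simp [peanoBakerTerm, Matrix.one_apply, hij]
  | succ n ih =>
    rw [pow_succ, mul_one_div]
    exact abs_apply_le_cosh_of_isPrimitiveOnIci
      (isPrimitiveOnIci_integral (locallyIntegrableOn_sum_abs hA) hτ) hτ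
      intervalIntegral.integral_same (isPrimitiveOnIci_peanoBakerTerm_succ hA hτ n i j)
      (congrFun₂ (peanoBakerTerm_succ_self A τ n) i j) ht
      fun σ hσ => ih (OrdConnected.uIcc_subset inferInstance hτ ht hσ)

theorem hasSum_peanoBakerTerm
    (hA : ∀ i j, LocallyIntegrableOn (fun t => A t i j) (Ici a) volume) (hτ : τ ∈ Ici a)
    (ht : t ∈ Ici a) : HasSum (fun n => peanoBakerTerm A τ n t) (stateTransition A t τ) :=
  Summable.hasSum <| Pi.summable.2 fun i => Pi.summable.2 fun j =>
    .of_norm_bounded (summable_geometric_two.mul_right _)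
      fun n => abs_peanoBakerTerm_apply_le hA hτ n ht i j

theorem isSolutionOnIci_stateTransition
    (hA : ∀ i j, LocallyIntegrableOn (fun t => A t i j) (Ici a) volume) (hτ : τ ∈ Ici a) :
    IsSolutionOnIci a A fun t => stateTransition A t τ := by
  intro i j
  have hw := locallyIntegrableOn_sum_abs hA
  have hentry {M : ℕ → Matrix (Fin N) (Fin N) ℝ} {S : Matrix (Fin N) (Fin N) ℝ}
      (h : HasSum M S) : HasSum (fun n => M n i j) (S i j) := Pi.hasSum.1 (Pi.hasSum.1 h i) j
  have hsum : IsPrimitiveOnIci a (fun t => stateTransition A t τ i j - (1 : Matrix _ _ ℝ) i j)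
      fun t => (A t * stateTransition A t τ) i j := by
    refine IsPrimitiveOnIci.hasSum (isPrimitiveOnIci_peanoBakerTerm_succ hA hτ · i j)
      (hw.mul_continuousOn (Real.continuous_cosh.comp_continuousOn
        ((isPrimitiveOnIci_integral hw hτ).continuousOn.const_mul 2))
        isClosed_Ici.isLocallyClosed)
      summable_geometric_two (fun n t ht => ?_) (fun t ht => ?_) fun t ht => ?_
    · rw [mul_left_comm]
      exact abs_mul_apply_le (abs_peanoBakerTerm_apply_le hA hτ n ht) i j
    · have h := (hasSum_nat_add_iff' 1).2 (hentry (hasSum_peanoBakerTerm hA hτ ht))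
      rwa [Finset.sum_range_one] at h
    · exact hentry ((hasSum_peanoBakerTerm hA hτ ht).mul_left (A t))
  refine ⟨hsum.locallyIntegrableOn, fun s hs t ht => ?_⟩
  rw [hsum.integral_eq_sub s hs t ht, sub_sub_sub_cancel_right]

theorem stateTransition_self (A : ℝ → Matrix (Fin N) (Fin N) ℝ) (τ : ℝ) :
    stateTransition A τ τ = 1 := by
  rw [stateTransition, tsum_eq_single 0]
  · rfl
  · intro n hn
    obtain ⟨m, rfl⟩ := Nat.exists_eq_succ_of_ne_zero hn
    exact peanoBakerTerm_succ_self A τ m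

theorem stateTransition_mul_stateTransition
    (hA : ∀ i j, LocallyIntegrableOn (fun t => A t i j) (Ici a) volume) (hτ : τ ∈ Ici a)
    (hs : s ∈ Ici a) (ht : t ∈ Ici a) :
    stateTransition A t s * stateTransition A s τ = stateTransition A t τ :=
  ((isSolutionOnIci_stateTransition hA hs).mul_const _).eq_of_eq hA
    (isSolutionOnIci_stateTransition hA hτ) hs (by rw [stateTransition_self, one_mul]) ht

theorem isUnit_stateTransition
    (hA : ∀ i j, LocallyIntegrableOn (fun t => A t i j) (Ici a) volume) (hτ : τ ∈ Ici a)
    (ht : t ∈ Ici a) : IsUnit (stateTransition A t τ) :=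
  .of_mul_eq_one (stateTransition A τ t) <| by
    rw [stateTransition_mul_stateTransition hA ht hτ ht, stateTransition_self]

theorem stateTransition_mulVec_of_forall_mulVec_eq_zero
    (hA : ∀ i j, LocallyIntegrableOn (fun t => A t i j) (Ici a) volume) {v : Fin N → ℝ}
    (hv : ∀ t ∈ Ici a, A t *ᵥ v = 0) (hτ : τ ∈ Ici a) (ht : t ∈ Ici a) :
    stateTransition A t τ *ᵥ v = v := by
  have hconst : IsSolutionOnIci a A fun _ => Matrix.replicateCol Unit v :=
    isSolutionOnIci_const hA fun t ht => by
      rw [← Matrix.replicateCol_mulVec, hv t ht, Matrix.replicateCol_zero]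
  rw [← Matrix.replicateCol_inj (ι := Unit), Matrix.replicateCol_mulVec]
  exact ((isSolutionOnIci_stateTransition hA hτ).mul_const _).eq_of_eq hA hconst hτ
    (by rw [stateTransition_self, Matrix.one_mul]) ht

theorem stateTransition_add_smul_one {w : ℝ → ℝ}
    (hA : ∀ i j, LocallyIntegrableOn (fun t => A t i j) (Ici a) volume)
    (hw : LocallyIntegrableOn w (Ici a) volume) (hτ : τ ∈ Ici a) (ht : t ∈ Ici a) :
    stateTransition (fun t => A t + w t • 1) t τ =
      Real.exp (∫ σ in τ..t, w σ) • stateTransition A t τ := by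
  have hAw (i j : Fin N) : LocallyIntegrableOn
      (fun t => (A t + w t • (1 : Matrix (Fin N) (Fin N) ℝ)) i j) (Ici a) volume :=
    (hA i j).add (hw.mul_continuousOn continuousOn_const isClosed_Ici.isLocallyClosed)
  refine (isSolutionOnIci_stateTransition hAw hτ).eq_of_eq hAw
    ((isSolutionOnIci_stateTransition hA hτ).exp_smul (isPrimitiveOnIci_integral hw hτ)) hτ ?_ ht
  rw [stateTransition_self, stateTransition_self, intervalIntegral.integral_same, Real.exp_zero,
    one_smul]

theorem peanoBakerTerm_nonneg (hA : ∀ t ∈ Ici τ, ∀ i j, 0 ≤ A t i j) (n : ℕ) (ht : t ∈ Ici τ)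
    (i j : Fin N) : 0 ≤ peanoBakerTerm A τ n t i j := by
  induction n generalizing t i j with
  | zero => by_cases hij : i = j <;> simp [peanoBakerTerm, Matrix.one_apply, hij]
  | succ n ih =>
    refine intervalIntegral.integral_nonneg ht fun σ hσ => ?_
    rw [Matrix.mul_apply]
    exact Finset.sum_nonneg fun k _ => mul_nonneg (hA σ hσ.1 i k) (ih hσ.1 k j)

theorem stateTransition_nonneg
    (hAi : ∀ i j, LocallyIntegrableOn (fun t => A t i j) (Ici τ) volume)
    (hA : ∀ t ∈ Ici τ, ∀ i j, 0 ≤ A t i j) (ht : t ∈ Ici τ) (i j : Fin N) :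
    0 ≤ stateTransition A t τ i j :=
  (Pi.hasSum.1 (Pi.hasSum.1 (hasSum_peanoBakerTerm hAi self_mem_Ici ht) i) j).nonneg
    fun n => peanoBakerTerm_nonneg hA n ht i j

end PeanoBaker

namespace IsIntensityChain

open scoped Matrix

variable {N : ℕ} {A : ℝ → Matrix (Fin N) (Fin N) ℝ} {τ t : ℝ}

/- Adding a multiple of the identity that makes `A` entrywise nonnegative only rescales `Φ`. -/
theorem stateTransition_nonneg (hA : IsIntensityChain A) (hτ : 0 ≤ τ) (ht : τ ≤ t)
    (i j : Fin N) : 0 ≤ stateTransition A t τ i j := by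
  have hsub : Ici τ ⊆ Ici (0 : ℝ) := Ici_subset_Ici.2 hτ
  have hAi (i j : Fin N) : LocallyIntegrableOn (fun t => A t i j) (Ici τ) volume :=
    (hA.locallyIntegrable i j).mono_set hsub
  set w : ℝ → ℝ := fun t => ∑ k, |A t k k|
  have hw : LocallyIntegrableOn w (Ici τ) volume :=
    locallyIntegrableOn_finsetSum _ fun k _ => (hAi k k).norm
  have hshift_nonneg : ∀ t ∈ Ici τ, ∀ i j,
      0 ≤ (A t + w t • (1 : Matrix (Fin N) (Fin N) ℝ)) i j := by
    intro t ht i j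
    rw [Matrix.add_apply, Matrix.smul_apply, smul_eq_mul]
    obtain rfl | hij := eq_or_ne i j
    · have hdiag : |A t i i| ≤ w t :=
        Finset.single_le_sum (f := fun k => |A t k k|) (fun _ _ => abs_nonneg _)
          (Finset.mem_univ i)
      rw [Matrix.one_apply_eq, mul_one]
      linarith [neg_abs_le (A t i i)]
    · rw [Matrix.one_apply_ne hij, mul_zero, add_zero]
      exact hA.offDiag_nonneg t (hsub ht) i j hij
  have hshift := _root_.stateTransition_nonneg (A := fun t => A t + w t • 1) (fun i j =>
    (hAi i j).add (hw.mul_continuousOn continuousOn_const isClosed_Ici.isLocallyClosed))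
    hshift_nonneg ht i j
  rw [stateTransition_add_smul_one hAi hw self_mem_Ici ht, Matrix.smul_apply] at hshift
  exact nonneg_of_mul_nonneg_right hshift (Real.exp_pos _)

theorem mulVec_one (hA : IsIntensityChain A) (ht : 0 ≤ t) : A t *ᵥ 1 = 0 := by
  ext i
  rw [Matrix.mulVec, dotProduct_one, hA.row_sum t ht i, Pi.zero_apply]

theorem stateTransition_mem_rowStochastic (hA : IsIntensityChain A) (hτ : 0 ≤ τ) (ht : τ ≤ t) :
    stateTransition A t τ ∈ Matrix.rowStochastic ℝ (Fin N) :=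
  Matrix.mem_rowStochastic.2 ⟨hA.stateTransition_nonneg hτ ht,
    stateTransition_mulVec_of_forall_mulVec_eq_zero hA.locallyIntegrable
      (fun _ hs => hA.mulVec_one hs) hτ (hτ.trans ht)⟩

end IsIntensityChain

section Convex

theorem tendsto_hausdorffEDist_iInter {ι X : Type*} [Preorder ι] [IsDirectedOrder ι] [Nonempty ι]
    [EMetricSpace X] {K : ι → Set X} (hK : Antitone K) (hc : ∀ t, IsCompact (K t)) :
    Tendsto (fun t => Metric.hausdorffEDist (K t) (⋂ s, K s)) atTop (𝓝 0) := by
  refine ENNReal.tendsto_nhds_zero.2 fun ε hε => ?_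
  set U : Set X := {x | Metric.infEDist x (⋂ s, K s) < ε}
  have hU : IsOpen U := isOpen_lt Metric.continuous_infEDist continuous_const
  have hsubU : ⋂ s, K s ⊆ U := fun x hx => (Metric.infEDist_zero_of_mem hx).trans_lt hε
  obtain ⟨s, hs⟩ : ∃ s, K s ⊆ U :=
    exists_subset_nhds_of_isCompact hK.directed_ge hc fun x hx => hU.mem_nhds (hsubU hx)
  filter_upwards [eventually_ge_atTop s] with t ht
  exact Metric.hausdorffEDist_le_of_infEDist (fun x hx => (hs (hK ht hx)).le)
    fun x hx => (Metric.infEDist_zero_of_mem (iInter_subset K t hx)).trans_le zero_le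

variable {𝕜 E : Type*} [Field 𝕜] [LinearOrder 𝕜] [AddCommGroup E] [Module 𝕜 E]

theorem span_convexHull (s : Set E) :
    Submodule.span 𝕜 (convexHull 𝕜 s) = Submodule.span 𝕜 s :=
  le_antisymm
    (Submodule.span_le.2 <| convexHull_min Submodule.subset_span (Submodule.span 𝕜 s).convex)
    (Submodule.span_mono (subset_convexHull 𝕜 s))

theorem eq_of_mem_extremePoints_of_sum_smul_eq [IsStrictOrderedRing 𝕜] {κ : Type*} [Fintype κ]
    {C : Set E} (hC : Convex 𝕜 C) {v : E} (hv : v ∈ C.extremePoints 𝕜) {w : κ → 𝕜}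
    (hw : w ∈ stdSimplex 𝕜 κ) {z : κ → E} (hz : ∀ i, z i ∈ C) (hsum : ∑ i, w i • z i = v) {j : κ}
    (hj : 0 < w j) : z j = v := by
  classical
  -- Moving from `v` away from `z j` by `w j` times their difference only lowers the `j`-th weight.
  have hmem : v + w j • (v - z j) ∈ C := by
    have h := hC.sum_mem (t := Finset.univ)
      (w := fun i => (1 + w j) * w i - Pi.single (M := fun _ => 𝕜) j (w j) i)
      (fun i _ => ?_) ?_ fun i _ => hz i
    · simp only [sub_smul, mul_smul, Finset.sum_sub_distrib, ← Finset.smul_sum, hsum,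
        Pi.single_apply, ite_smul, zero_smul, Finset.sum_ite_eq', Finset.mem_univ, if_true] at h
      convert h using 1
      module
    · obtain rfl | hij := eq_or_ne i j
      · rw [Pi.single_eq_same]
        nlinarith
      · rw [Pi.single_eq_of_ne hij, sub_zero]
        exact mul_nonneg (by positivity) (hw.1 i)
    · rw [Finset.sum_sub_distrib, ← Finset.mul_sum, hw.2, Finset.sum_pi_single']
      simp
  refine ((mem_extremePoints.1 hv).2 (z j) (hz j) _ hmem ?_).1
  refine ⟨w j / (1 + w j), 1 / (1 + w j), by positivity, by positivity, by field_simp; ring, ?_⟩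
  have : 1 + w j ≠ 0 := by positivity
  match_scalars
  · field_simp
    ring
  · field_simp

theorem convexHull_extremePoints_convexHull {E : Type*} [AddCommGroup E] [Module ℝ E]
    [TopologicalSpace E] [T2Space E] [IsTopologicalAddGroup E] [ContinuousSMul ℝ E]
    [LocallyConvexSpace ℝ E] {s : Set E} (hs : s.Finite) :
    convexHull ℝ ((convexHull ℝ s).extremePoints ℝ) = convexHull ℝ s := by
  have hfin : ((convexHull ℝ s).extremePoints ℝ).Finite :=
    hs.subset extremePoints_convexHull_subset
  rw [← (hfin.isClosed_convexHull ℝ).closure_eq,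
    closure_convexHull_extremePoints (hs.isCompact_convexHull ℝ) (convex_convexHull ℝ s)]

end Convex

theorem linearIndependent_of_disjoint_support {κ m R : Type*} [Ring R] [NoZeroDivisors R]
    {L : κ → m → R} (hne : ∀ a, L a ≠ 0)
    (hdisj : Pairwise fun a b => Disjoint (Function.support (L a)) (Function.support (L b))) :
    LinearIndependent R L := by
  refine linearIndependent_iff'.2 fun s g hg a ha => ?_
  obtain ⟨j, hj⟩ := Function.ne_iff.1 (hne a)
  have hgj := congrFun hg j
  rw [Finset.sum_apply, Finset.sum_eq_single_of_mem a ha fun b _ hba => ?_] at hgj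
  · exact (mul_eq_zero.1 hgj).resolve_right hj
  · have hbj : L b j = 0 := Function.notMem_support.1 (disjoint_left.1 (hdisj hba.symm) hj)
    rw [Pi.smul_apply, hbj, smul_zero]

section RowHull

open scoped Matrix

variable {ι κ m n : Type*}

/-- The convex hull of the rows of a matrix: for the transition matrix `Φ(t, τ)` this is the
polytope `C_{t,τ}`. -/
def rowHull (M : Matrix m n ℝ) : Set (n → ℝ) :=
  convexHull ℝ (range M.row)

theorem row_mem_rowHull (M : Matrix m n ℝ) (i : m) : M i ∈ rowHull M :=
  subset_convexHull ℝ _ ⟨i, rfl⟩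

theorem isCompact_rowHull [Finite m] (M : Matrix m n ℝ) : IsCompact (rowHull M) :=
  (finite_range _).isCompact_convexHull ℝ

theorem finite_extremePoints_rowHull [Finite m] (M : Matrix m n ℝ) :
    ((rowHull M).extremePoints ℝ).Finite :=
  (finite_range _).subset extremePoints_convexHull_subset

theorem ncard_extremePoints_rowHull [Finite m] [Fintype n] {M : Matrix m n ℝ}
    (hM : LinearIndependent ℝ ((↑) : (rowHull M).extremePoints ℝ → n → ℝ)) :
    ((rowHull M).extremePoints ℝ).ncard = M.rank := by
  have := (finite_extremePoints_rowHull M).fintype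
  rw [← Nat.card_coe_set_eq, Nat.card_eq_fintype_card, ← finrank_span_eq_card hM,
    Subtype.range_coe, ← span_convexHull, rowHull,
    convexHull_extremePoints_convexHull (finite_range _), span_convexHull,
    Matrix.rank_eq_finrank_span_row]

theorem mem_rowHull_iff [Fintype m] {M : Matrix m n ℝ} {x : n → ℝ} :
    x ∈ rowHull M ↔ ∃ w ∈ stdSimplex ℝ m, w ᵥ* M = x := by
  classical
  have hrow : M.vecMulLinear ∘ (fun i => Pi.single i (1 : ℝ)) = M.row :=
    funext fun i => Matrix.single_one_vecMul i M
  have himage := M.vecMulLinear.image_convexHull (range fun i => Pi.single i (1 : ℝ))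
  rw [convexHull_rangle_single_eq_stdSimplex, ← range_comp, hrow] at himage
  rw [rowHull, ← himage]
  rfl

theorem rowHull_mul_subset [Fintype m] [DecidableEq m] {S : Matrix m m ℝ}
    (hS : S ∈ Matrix.rowStochastic ℝ m) (M : Matrix m n ℝ) : rowHull (S * M) ⊆ rowHull M := by
  refine convexHull_min (range_subset_iff.2 fun i => ?_) (convex_convexHull ℝ _)
  have hSi : S i ∈ stdSimplex ℝ m :=
    ⟨fun _ => Matrix.nonneg_of_mem_rowStochastic hS, Matrix.sum_row_of_mem_rowStochastic hS i⟩
  exact mem_rowHull_iff.2 ⟨S i, hSi, rfl⟩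

theorem exists_tendsto_weights [Fintype m] {𝒰 : Ultrafilter ι} {P : ι → Matrix m n ℝ}
    {Q : Matrix m n ℝ} (hPQ : Tendsto P 𝒰 (𝓝 Q)) {x : κ → n → ℝ} (hx : ∀ t a, x a ∈ rowHull (P t)) :
    ∃ (W : ι → κ → m → ℝ) (L : κ → m → ℝ), Tendsto W 𝒰 (𝓝 L) ∧ (∀ t a, W t a ᵥ* P t = x a) ∧
      ∀ a, L a ∈ stdSimplex ℝ m ∧ L a ᵥ* Q = x a := by
  choose W hW hWx using fun t a => mem_rowHull_iff.1 (hx t a)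
  have hcompact := isCompact_univ_pi fun _ : κ => isCompact_stdSimplex ℝ m
  obtain ⟨L, hL, hWL⟩ := hcompact.ultrafilter_le_nhds' (𝒰.map W)
    (Ultrafilter.mem_map.2 (univ_mem' fun t a _ => hW t a))
  refine ⟨W, L, hWL, hWx, fun a => ⟨hL a trivial, ?_⟩⟩
  have hcont : Continuous fun p : (m → ℝ) × Matrix m n ℝ => p.1 ᵥ* p.2 :=
    continuous_fst.matrix_vecMul continuous_snd
  have hlim := (hcont.tendsto (L a, Q)).comp ((tendsto_pi_nhds.1 hWL a).prodMk_nhds hPQ)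
  exact tendsto_nhds_unique hlim (tendsto_const_nhds.congr fun t => (hWx t a).symm)

/- The weights of distinct extreme points on the rows of `Q` have disjoint supports, so they are
independent, and so are the nearby weights of the same points on the independent rows of `P t`. -/
theorem linearIndependent_extremePoints_rowHull [Finite m] [Finite n] {𝒰 : Ultrafilter ι}
    {P : ι → Matrix m n ℝ} {Q : Matrix m n ℝ} (hPQ : Tendsto P 𝒰 (𝓝 Q))
    (hP : ∀ t, LinearIndependent ℝ (P t).row) (hsub : ∀ t, rowHull Q ⊆ rowHull (P t)) :
    LinearIndependent ℝ ((↑) : (rowHull Q).extremePoints ℝ → n → ℝ) := by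
  have := Fintype.ofFinite m
  have := (finite_extremePoints_rowHull Q).to_subtype
  obtain ⟨W, L, hWL, hWx, hL⟩ := exists_tendsto_weights hPQ
    fun t (v : (rowHull Q).extremePoints ℝ) => hsub t v.2.1
  have hsupp (v) (j) (hj : j ∈ Function.support (L v)) : Q j = v :=
    eq_of_mem_extremePoints_of_sum_smul_eq (convex_convexHull ℝ _) v.2 (hL v).1
      (row_mem_rowHull Q) (by rw [← Matrix.vecMul_eq_sum, (hL v).2])
      (((hL v).1.1 j).lt_of_ne' hj)
  have hLindep : LinearIndependent ℝ L := by
    refine linearIndependent_of_disjoint_support (fun v hv => ?_) fun v v' hne =>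
      disjoint_left.2 fun j hj hj' =>
        hne (Subtype.ext ((hsupp v j hj).symm.trans (hsupp v' j hj')))
    simpa [hv] using (hL v).1.2
  obtain ⟨t, ht⟩ := (hWL.eventually (isOpen_setOfPred_linearIndependent.mem_nhds hLindep)).exists
  have hker : LinearMap.ker (P t).vecMulLinear = ⊥ :=
    LinearMap.ker_eq_bot.2 (Matrix.vecMul_injective_iff.2 (hP t))
  exact (funext (hWx t) : (P t).vecMulLinear ∘ W t = _) ▸ ht.map' _ hker

end RowHull

section StochasticEvolution

open scoped Matrix

variable {ι m n : Type*} [Fintype m] [DecidableEq m]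

theorem isCompact_rowStochastic : IsCompact (Matrix.rowStochastic ℝ m : Set (Matrix m m ℝ)) := by
  have h : (Matrix.rowStochastic ℝ m : Set (Matrix m m ℝ)) =
      Set.pi univ fun _ : m => stdSimplex ℝ m := by
    ext M
    rw [SetLike.mem_coe, Matrix.mem_rowStochastic_iff_sum]
    exact ⟨fun h i _ => ⟨h.1 i, h.2 i⟩, fun h =>
      ⟨fun i => (h i trivial).1, fun i => (h i trivial).2⟩⟩
  exact h ▸ isCompact_univ_pi fun _ => isCompact_stdSimplex ℝ m

theorem norm_mulVec_le_of_mem_rowStochastic {S : Matrix m m ℝ}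
    (hS : S ∈ Matrix.rowStochastic ℝ m) (v : m → ℝ) : ‖S *ᵥ v‖ ≤ ‖v‖ := by
  have hS_nonneg (i j : m) : 0 ≤ S i j := Matrix.nonneg_of_mem_rowStochastic hS
  refine (pi_norm_le_iff_of_nonneg (norm_nonneg v)).2 fun i => ?_
  calc ‖∑ j, S i j * v j‖ ≤ ∑ j, S i j * ‖v‖ := norm_sum_le_of_le _ fun j _ => by
        rw [norm_mul, Real.norm_of_nonneg (hS_nonneg i j)]
        exact mul_le_mul_of_nonneg_left (norm_le_pi_norm v j) (hS_nonneg i j)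
    _ = ‖v‖ := by rw [← Finset.sum_mul, Matrix.sum_row_of_mem_rowStochastic hS, one_mul]

variable [Preorder ι]

/-- A family of matrices in which each member arises from every earlier one by left multiplication
by a row-stochastic matrix. It captures what the convergence argument uses of `t ↦ Φ(t, τ)`. -/
def IsStochasticEvolution (P : ι → Matrix m n ℝ) : Prop :=
  ∀ ⦃s t⦄, s ≤ t → ∃ S ∈ Matrix.rowStochastic ℝ m, P t = S * P s

namespace IsStochasticEvolution

variable {P : ι → Matrix m n ℝ} {Q : Matrix m n ℝ} {𝒰 : Ultrafilter ι}

theorem antitone_rowHull (hP : IsStochasticEvolution P) : Antitone fun t => rowHull (P t) := by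
  intro s t hst
  obtain ⟨S, hS, hPt⟩ := hP hst
  exact (congrArg rowHull hPt).trans_subset (rowHull_mul_subset hS _)

theorem antitone_norm_mulVec [Fintype n] (hP : IsStochasticEvolution P) (v : n → ℝ) :
    Antitone fun t => ‖P t *ᵥ v‖ := by
  intro s t hst
  obtain ⟨S, hS, hPt⟩ := hP hst
  dsimp only
  rw [hPt, ← Matrix.mulVec_mulVec]
  exact norm_mulVec_le_of_mem_rowStochastic hS _

theorem rowHull_subset (hP : IsStochasticEvolution P) (h𝒰 : (𝒰 : Filter ι) ≤ atTop)
    (hPQ : Tendsto P 𝒰 (𝓝 Q)) (t : ι) : rowHull Q ⊆ rowHull (P t) := by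
  refine convexHull_min (range_subset_iff.2 fun i => ?_) (convex_convexHull ℝ _)
  refine (isCompact_rowHull (P t)).isClosed.mem_of_tendsto (tendsto_pi_nhds.1 hPQ i) ?_
  filter_upwards [h𝒰 (eventually_ge_atTop t)] with s hs
  exact hP.antitone_rowHull hs (row_mem_rowHull _ i)

theorem iInter_rowHull_eq (hP : IsStochasticEvolution P)
    (h𝒰 : (𝒰 : Filter ι) ≤ atTop) (hPQ : Tendsto P 𝒰 (𝓝 Q)) : ⋂ t, rowHull (P t) = rowHull Q := by
  refine Subset.antisymm (fun x hx => ?_) (subset_iInter (hP.rowHull_subset h𝒰 hPQ))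
  obtain ⟨-, L, -, -, hL⟩ :=
    exists_tendsto_weights (κ := Unit) hPQ fun t _ => mem_iInter.1 hx t
  exact mem_rowHull_iff.2 ⟨L (), hL ()⟩

variable [IsDirectedOrder ι] [Nonempty ι]

theorem exists_ultrafilter_tendsto (hP : IsStochasticEvolution P) :
    ∃ (𝒰 : Ultrafilter ι) (Q : Matrix m n ℝ),
      (𝒰 : Filter ι) ≤ atTop ∧ Tendsto P 𝒰 (𝓝 Q) := by
  let s : ι := Classical.arbitrary ι
  let C : Set (Matrix m n ℝ) := (· * P s) '' (Matrix.rowStochastic ℝ m : Set (Matrix m m ℝ))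
  have hC : IsCompact C :=
    isCompact_rowStochastic.image (continuous_id.matrix_mul continuous_const)
  have hmem : ∀ᶠ t in atTop, P t ∈ C := by
    filter_upwards [eventually_ge_atTop s] with t ht
    obtain ⟨S, hS, hPt⟩ := hP ht
    exact ⟨S, hS, hPt.symm⟩
  obtain ⟨Q, -, hQ⟩ := hC.ultrafilter_le_nhds' ((Ultrafilter.of atTop).map P)
    (Ultrafilter.of_le atTop hmem)
  exact ⟨Ultrafilter.of atTop, Q, Ultrafilter.of_le atTop, hQ⟩

theorem tendsto_mulVec_zero_iff [Fintype n] (hP : IsStochasticEvolution P)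
    (h𝒰 : (𝒰 : Filter ι) ≤ atTop) (hPQ : Tendsto P 𝒰 (𝓝 Q)) {v : n → ℝ} :
    Tendsto (fun t => P t *ᵥ v) atTop (𝓝 0) ↔ Q *ᵥ v = 0 := by
  have hcont : Continuous fun M : Matrix m n ℝ => M *ᵥ v :=
    continuous_id.matrix_mulVec continuous_const
  have hlim : Tendsto (fun t => P t *ᵥ v) 𝒰 (𝓝 (Q *ᵥ v)) := (hcont.tendsto Q).comp hPQ
  have hnorm := tendsto_atTop_ciInf (hP.antitone_norm_mulVec v)
    ⟨0, forall_mem_range.2 fun t => norm_nonneg _⟩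
  have hnormQ := tendsto_nhds_unique (hnorm.mono_left h𝒰) hlim.norm
  rw [tendsto_zero_iff_norm_tendsto_zero, ← norm_eq_zero, ← hnormQ]
  exact ⟨tendsto_nhds_unique hnorm, fun h => h ▸ hnorm⟩

end IsStochasticEvolution

end StochasticEvolution

theorem limitPolytope_eq_iInter {N : ℕ} (A : ℝ → Matrix (Fin N) (Fin N) ℝ) (τ : ℝ) :
    limitPolytope A τ = ⋂ t : Ici τ, rowHull (stateTransition A t τ) :=
  biInter_eq_iInter _ _

namespace IsIntensityChain

open scoped Matrix

variable {N : ℕ} {A : ℝ → Matrix (Fin N) (Fin N) ℝ} {τ : ℝ}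

theorem isStochasticEvolution (hA : IsIntensityChain A) (hτ : 0 ≤ τ) :
    IsStochasticEvolution fun t : Ici τ => stateTransition A t τ := fun s t hst =>
  ⟨stateTransition A t s, hA.stateTransition_mem_rowStochastic (hτ.trans s.2) hst,
    (stateTransition_mul_stateTransition hA.locallyIntegrable hτ (hτ.trans s.2)
      (hτ.trans t.2)).symm⟩

theorem linearIndependent_row_stateTransition (hA : IsIntensityChain A) (hτ : 0 ≤ τ)
    (t : Ici τ) : LinearIndependent ℝ (stateTransition A t τ).row :=
  Matrix.linearIndependent_rows_iff_isUnit.2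
    (isUnit_stateTransition hA.locallyIntegrable hτ (hτ.trans t.2))

theorem antitoneOn_polytope (hA : IsIntensityChain A) (hτ : 0 ≤ τ) :
    AntitoneOn (fun t => polytope A t τ) (Ici τ) :=
  antitoneOn_iff_antitone.2 (hA.isStochasticEvolution hτ).antitone_rowHull

theorem tendsto_hausdorffEDist_polytope (hA : IsIntensityChain A) (hτ : 0 ≤ τ) :
    Tendsto (fun t => Metric.hausdorffEDist (polytope A t τ) (limitPolytope A τ)) atTop
      (𝓝 0) := by
  rw [← tendsto_comp_val_Ici_atTop (a := τ), limitPolytope_eq_iInter]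
  exact tendsto_hausdorffEDist_iInter (hA.isStochasticEvolution hτ).antitone_rowHull
    fun t => isCompact_rowHull _

theorem exists_limitPolytope_eq_rowHull (hA : IsIntensityChain A) (hτ : 0 ≤ τ) :
    ∃ Q : Matrix (Fin N) (Fin N) ℝ, limitPolytope A τ = rowHull Q ∧
      LinearIndependent ℝ ((↑) : (rowHull Q).extremePoints ℝ → Fin N → ℝ) ∧
      nullSpace A τ = LinearMap.ker Q.mulVecLin := by
  have hev := hA.isStochasticEvolution hτ
  obtain ⟨𝒰, Q, h𝒰, hQ⟩ := hev.exists_ultrafilter_tendsto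
  refine ⟨Q, (limitPolytope_eq_iInter A τ).trans (hev.iInter_rowHull_eq h𝒰 hQ),
    linearIndependent_extremePoints_rowHull hQ (hA.linearIndependent_row_stateTransition hτ)
      (hev.rowHull_subset h𝒰 hQ), Submodule.ext fun v => ?_⟩
  exact tendsto_comp_val_Ici_atTop.symm.trans (hev.tendsto_mulVec_zero_iff h𝒰 hQ)

theorem finrank_nullSpace (hA : IsIntensityChain A) (hτ : 0 ≤ τ) :
    Module.finrank ℝ (nullSpace A τ) = nullity A := by
  have hunit := isUnit_stateTransition hA.locallyIntegrable self_mem_Ici hτ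
  let e : (Fin N → ℝ) ≃ₗ[ℝ] (Fin N → ℝ) := .ofBijective (stateTransition A τ 0).mulVecLin
    ⟨Matrix.mulVec_injective_of_isUnit hunit, Matrix.mulVec_surjective_iff_isUnit.2 hunit⟩
  have hmem (v : Fin N → ℝ) : e v ∈ nullSpace A τ ↔ v ∈ nullSpace A 0 := by
    refine tendsto_congr' ?_
    filter_upwards [eventually_ge_atTop τ] with t ht
    change stateTransition A t τ *ᵥ (stateTransition A τ 0 *ᵥ v) = _
    rw [Matrix.mulVec_mulVec, stateTransition_mul_stateTransition hA.locallyIntegrable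
      self_mem_Ici hτ (hτ.trans ht)]
  have hmap : nullSpace A τ = (nullSpace A 0).map (e : (Fin N → ℝ) →ₗ[ℝ] (Fin N → ℝ)) := by
    ext v
    rw [Submodule.mem_map_equiv, ← hmem, LinearEquiv.apply_symm_apply]
  rw [hmap, nullity]
  exact e.finrank_map_eq _

end IsIntensityChain

theorem theorem2 {N : ℕ} (A : ℝ → Matrix (Fin N) (Fin N) ℝ) (hA : IsIntensityChain A) :
    (∀ τ, 0 ≤ τ → Module.finrank ℝ (nullSpace A τ) = nullity A) ∧
    ∃ c : ℕ,
      (∀ τ, 0 ≤ τ →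
        AntitoneOn (fun t => polytope A t τ) (Ici τ) ∧
        Tendsto (fun t => Metric.hausdorffEDist (polytope A t τ) (limitPolytope A τ))
          atTop (𝓝 0) ∧
        (∃ F : Finset (Fin N → ℝ), limitPolytope A τ = convexHull ℝ (F : Set (Fin N → ℝ))) ∧
        (limitVertices A τ).Finite ∧
        (limitVertices A τ).ncard = c ∧
        LinearIndependent ℝ (fun v : limitVertices A τ => (v : Fin N → ℝ))) ∧
      chainRank A = c := by
  refine ⟨fun τ hτ => hA.finrank_nullSpace hτ, chainRank A, fun τ hτ =>
    ⟨hA.antitoneOn_polytope hτ, hA.tendsto_hausdorffEDist_polytope hτ, ?_⟩, rfl⟩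
  obtain ⟨Q, hQ, hindep, hker⟩ := hA.exists_limitPolytope_eq_rowHull hτ
  have hrank : Q.rank = chainRank A := by
    have h := LinearMap.finrank_range_add_finrank_ker Q.mulVecLin
    rw [← hker, hA.finrank_nullSpace hτ, Module.finrank_fin_fun] at h
    exact Nat.eq_sub_of_add_eq h
  rw [limitVertices, hQ]
  exact ⟨⟨(finite_range Q.row).toFinset, by rw [(finite_range Q.row).coe_toFinset, rowHull]⟩,
    finite_extremePoints_rowHull Q, (ncard_extremePoints_rowHull hindep).trans hrank, hindep⟩
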